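/- Let $N$ be a real analytic manifold of dimension $d$, and let $Y_0, Y_1,\dots,Y_r$ be real analytic vector fields on $N$. Let $\mathcal I$ be the smallest real vector space of vector fields on $N$ that contains $Y_1,\dots,Y_r$ and satisfies $[V,W]\in\mathcal I$ and $[Y_0,V]\in\mathcal I$ for all $V,W\in\mathcal I$ (that is, the ideal generated by $Y_1,\dots,Y_r$ in the Lie algebra generated by $Y_0,\dots,Y_r$). The collection $\{Y_0;Y_1,\dots,Y_r\}$ satisfies the *parabolic Hörmander condition at* $y\in N$ if $\{V(y) : V\in\mathcal I\}$ spans $T_yN$. A *smooth hypersurface* is an embedded, not necessarily closed, smooth submanifold of dimension $d-1$. The following are equivalent: 1. There exists a set $B\subseteq N$ such that both of the following hold. - (H1) The parabolic Hörmander condition holds at every $y\in N\setminus B$, and $B$ lies locally on smooth hypersurfaces: every $y\in B$ has an open neighbourhood $U$ such that $B\cap U$ is contained in a smooth hypersurface of $N$. - (H2) For every $y\in B$ there are a chart $(\varphi,U)$ of the analytic manifold $N$ with $y\in U$ and a smooth function $\Phi:\varphi(U)\to\mathbb R$ such that $O=\{x\in\varphi(U):\Phi(x)=0\}$ is a smooth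 hypersurface of $\mathbb R^d$, $\varphi(U\cap B)\subseteq O$, and $Y_k(\Phi\circ\varphi)(y)\neq 0$ for some $k\in\{0,1,\dots,r\}$. 2. $\{Y_0;Y_1,\dots,Y_r\}$ satisfies the parabolic Hörmander condition at every point of $N$. -/

import Mathlib

open scoped Manifold ContDiff

/-- The family `Y` consists of real analytic vector fields, i.e. each `Y k` is a real analytic
section of the tangent bundle. -/
def AnalyticVectorFields {d r : ℕ} {N : Type*} [TopologicalSpace N]
    [ChartedSpace (EuclideanSpace ℝ (Fin d)) N] [IsManifold (𝓡 d) ω N]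
    (Y : Fin (r + 1) → (x : N) → TangentSpace (𝓡 d) x) : Prop :=
  ∀ k, ContMDiff (𝓡 d) (𝓡 d).tangent ω (fun x => (⟨x, Y k x⟩ : TangentBundle (𝓡 d) N))

/-- `ParabolicLieAlgebra Y V`: the vector field `V` belongs to the Lie algebra of the parabolic
Hörmander condition for `{Y 0; Y 1, …, Y r}`, with drift `Y 0`. This is the smallest real linear
space of vector fields which contains `Y 1, …, Y r` and is closed under Lie brackets of its
elements and under Lie brackets with `Y 0`; the drift `Y 0` itself is not a generator.
Equivalently, it is the ideal generated by `Y 1, …, Y r` in the Lie algebra generated by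
`Y 0, …, Y r`. -/
inductive ParabolicLieAlgebra {d r : ℕ} {N : Type*} [TopologicalSpace N]
    [ChartedSpace (EuclideanSpace ℝ (Fin d)) N]
    (Y : Fin (r + 1) → (x : N) → TangentSpace (𝓡 d) x) :
    ((x : N) → TangentSpace (𝓡 d) x) → Prop
  | generator (k : Fin r) : ParabolicLieAlgebra Y (Y k.succ)
  | zero : ParabolicLieAlgebra Y 0
  | add {V W : (x : N) → TangentSpace (𝓡 d) x} :
      ParabolicLieAlgebra Y V → ParabolicLieAlgebra Y W → ParabolicLieAlgebra Y (V + W)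
  | smul (c : ℝ) {V : (x : N) → TangentSpace (𝓡 d) x} :
      ParabolicLieAlgebra Y V → ParabolicLieAlgebra Y (c • V)
  | bracket {V W : (x : N) → TangentSpace (𝓡 d) x} :
      ParabolicLieAlgebra Y V → ParabolicLieAlgebra Y W →
        ParabolicLieAlgebra Y (VectorField.mlieBracket (𝓡 d) V W)
  | drift {V : (x : N) → TangentSpace (𝓡 d) x} :
      ParabolicLieAlgebra Y V →
        ParabolicLieAlgebra Y (VectorField.mlieBracket (𝓡 d) (Y 0) V)

/-- The parabolic Hörmander condition at the point `y`. -/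
def ParabolicHormanderAt {d r : ℕ} {N : Type*} [TopologicalSpace N]
    [ChartedSpace (EuclideanSpace ℝ (Fin d)) N]
    (Y : Fin (r + 1) → (x : N) → TangentSpace (𝓡 d) x) (y : N) : Prop :=
  Submodule.span ℝ {v : TangentSpace (𝓡 d) y | ∃ V, ParabolicLieAlgebra Y V ∧ V y = v} = ⊤

/-- `S` is an (embedded, not necessarily closed) smooth submanifold of dimension `d - 1` of the
`d`-dimensional manifold `N`: near each of its points it is the zero set of a smooth real
function whose differential at that point is non-zero. -/
def IsSmoothHypersurface {d : ℕ} {N : Type*} [TopologicalSpace N]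
    [ChartedSpace (EuclideanSpace ℝ (Fin d)) N] (S : Set N) : Prop :=
  ∀ y ∈ S, ∃ W : Set N, IsOpen W ∧ y ∈ W ∧ ∃ f : N → ℝ,
    ContMDiffOn (𝓡 d) 𝓘(ℝ, ℝ) ∞ f W ∧ S ∩ W = {z | z ∈ W ∧ f z = 0} ∧
      mfderiv (𝓡 d) 𝓘(ℝ, ℝ) f y ≠ 0

/-- Condition (H1) for the exceptional set `B`: the parabolic Hörmander condition holds at each
point outside `B`, and `B` lies locally on smooth hypersurfaces. -/
def ConditionH1 {d r : ℕ} {N : Type*} [TopologicalSpace N]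
    [ChartedSpace (EuclideanSpace ℝ (Fin d)) N]
    (Y : Fin (r + 1) → (x : N) → TangentSpace (𝓡 d) x) (B : Set N) : Prop :=
  (∀ y ∉ B, ParabolicHormanderAt Y y) ∧
    ∀ y ∈ B, ∃ U : Set N, IsOpen U ∧ y ∈ U ∧
      ∃ S : Set N, IsSmoothHypersurface (d := d) S ∧ B ∩ U ⊆ S

/-- Condition (H2) for the exceptional set `B`: around each `y ∈ B` there is a chart `φ` of the
analytic manifold that maps `B` into a smooth hypersurface `{Φ = 0}` of the coordinate domain,
such that the derivative of `Φ` (read on `N` as `Φ ∘ φ`) along some `Y k`, `0 ≤ k ≤ r`, does not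
vanish at `y`. -/
def ConditionH2 {d r : ℕ} {N : Type*} [TopologicalSpace N]
    [ChartedSpace (EuclideanSpace ℝ (Fin d)) N] [IsManifold (𝓡 d) ω N]
    (Y : Fin (r + 1) → (x : N) → TangentSpace (𝓡 d) x) (B : Set N) : Prop :=
  ∀ y ∈ B, ∃ φ ∈ IsManifold.maximalAtlas (𝓡 d) ω N, y ∈ φ.source ∧
    ∃ Φ : EuclideanSpace ℝ (Fin d) → ℝ,
      ContDiffOn ℝ ∞ Φ φ.target ∧
      IsSmoothHypersurface (d := d) {x | x ∈ φ.target ∧ Φ x = 0} ∧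
      φ '' (B ∩ φ.source) ⊆ {x | x ∈ φ.target ∧ Φ x = 0} ∧
      ∃ k : Fin (r + 1), mfderiv (𝓡 d) 𝓘(ℝ, ℝ) (Φ ∘ φ) y (Y k y) ≠ (0 : ℝ)

/-! Suppose a nonzero covector `l` at a point of `B` annihilates the ideal. By (H2) some `Y k` is
transverse to the hypersurface there. Transport `l` along the integral curve `γ` of `Y k` by p' = -p
∘ Df(γ), where `f` is `Y k` in a chart. For `V` in the ideal, p(V(γ)) has derivative p([f, V](γ)),
and [f, V] is again in the ideal. So all derivatives vanish at time 0, and by analyticity p(V(γ)) is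
zero near 0 (`exists_integralCurve_annihilator`). But `γ` leaves the hypersurface at once and
reaches points outside `B`, where the Hörmander condition forbids such a p. The analytic input is
that integral curves of analytic fields are analytic (`AnalyticAt.analyticAt_integralCurve`). -/

open Set Filter Topology

/-! ### Analyticity of superposition operators on spaces of continuous functions -/

/-- A formal multilinear series acts pointwise on continuous functions. -/
noncomputable def FormalMultilinearSeries.pointwise {E F : Type*} [NormedAddCommGroup E]
    [NormedSpace ℝ E] [NormedAddCommGroup F] [NormedSpace ℝ F] (K : Type*) [TopologicalSpace K]
    [CompactSpace K] (p : FormalMultilinearSeries ℝ E F) :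
    FormalMultilinearSeries ℝ C(K, E) C(K, F) := fun n =>
  MultilinearMap.mkContinuous
    { toFun := fun m => ⟨fun s => p n fun i => m i s, by fun_prop⟩
      map_update_add' := by
        intro _ m i x y
        ext s
        have h (z : C(K, E)) : (fun j => Function.update m i z j s) =
            Function.update (fun j => m j s) i (z s) := by
          ext j; by_cases hj : j = i
          · subst hj; simp
          · simp [hj]
        simp [h]
      map_update_smul' := by
        intro _ m i c x
        ext s
        have h (z : C(K, E)) : (fun j => Function.update m i z j s) =
            Function.update (fun j => m j s) i (z s) := by
          ext j; by_cases hj : j = i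
          · subst hj; simp
          · simp [hj]
        simp [h] }
    ‖p n‖ (by
      intro m
      refine (ContinuousMap.norm_le _ (by positivity)).2 fun s => ?_
      refine ((p n).le_opNorm _).trans ?_
      gcongr with i
      exact (m i).norm_coe_le_norm s)

section Pointwise

variable {E F : Type*} [NormedAddCommGroup E] [NormedSpace ℝ E] [NormedAddCommGroup F]
  [NormedSpace ℝ F] {K : Type*} [TopologicalSpace K] [CompactSpace K]

theorem FormalMultilinearSeries.radius_le_radius_pointwise (p : FormalMultilinearSeries ℝ E F) :
    p.radius ≤ (p.pointwise K).radius :=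
  FormalMultilinearSeries.radius_le_of_le fun _ =>
    MultilinearMap.mkContinuous_norm_le _ (norm_nonneg _) _

/-- Evaluation at `s` is continuous and linear, so it commutes with the sum. Hence composition with
an analytic function is itself analytic on `C(K, E)` near 0. -/
theorem FormalMultilinearSeries.sum_pointwise_apply [CompleteSpace F]
    (p : FormalMultilinearSeries ℝ E F) {ψ : C(K, E)}
    (hψ : ψ ∈ Metric.eball (0 : C(K, E)) p.radius) (s : K) :
    (p.pointwise K).sum ψ s = p.sum (ψ s) := by
  have h := (p.pointwise K).hasSum (x := ψ)
    (Metric.eball_subset_eball p.radius_le_radius_pointwise hψ)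
  have h2 := h.mapL (ContinuousMap.evalCLM ℝ s : C(K, F) →L[ℝ] F)
  exact h2.tsum_eq.symm

end Pointwise

/-! ### Analyticity of integral curves -/

section ODE

variable {E : Type*} [NormedAddCommGroup E] [NormedSpace ℝ E]

/-- The primitive vanishing at `0`, as an operator on continuous functions on `[0, 1]`. -/
noncomputable def unitPrimitive : C(Icc (0 : ℝ) 1, E) →L[ℝ] C(Icc (0 : ℝ) 1, E) :=
  LinearMap.mkContinuous
    { toFun := fun g => ⟨fun s => ∫ u in (0 : ℝ)..s, g (projIcc 0 1 zero_le_one u), by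
        refine Continuous.comp (g := fun s : ℝ => ∫ u in (0 : ℝ)..s, g (projIcc 0 1 zero_le_one u))
          ?_ continuous_subtype_val
        refine intervalIntegral.continuous_primitive (fun a b => ?_) 0
        exact (g.continuous.comp continuous_projIcc).intervalIntegrable _ _⟩
      map_add' := by
        intro g h
        ext s
        exact intervalIntegral.integral_add
          ((g.continuous.comp continuous_projIcc).intervalIntegrable _ _)
          ((h.continuous.comp continuous_projIcc).intervalIntegrable _ _)
      map_smul' := by
        intro c g
        ext s
        exact intervalIntegral.integral_smul c _ }
    1 (by
      intro g
      refine (ContinuousMap.norm_le _ (by positivity)).2 fun s => ?_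
      refine (intervalIntegral.norm_integral_le_of_norm_le_const
        (C := ‖g‖) fun u _ => g.norm_coe_le_norm _).trans ?_
      rw [sub_zero, abs_of_nonneg s.2.1, one_mul]
      exact mul_le_of_le_one_right (norm_nonneg _) s.2.2)

theorem unitPrimitive_apply (g : C(Icc (0 : ℝ) 1, E)) (s : Icc (0 : ℝ) 1) :
    unitPrimitive g s = ∫ u in (0 : ℝ)..s, g (projIcc 0 1 zero_le_one u) :=
  rfl

/-- Small solutions `x` of the fixed point equation `x = ε • H x` depend analytically on `ε`. -/
theorem AnalyticAt.exists_analyticAt_eq_smul [CompleteSpace E] {H : E → E}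
    (hH : AnalyticAt ℝ H 0) :
    ∃ Ψ : ℝ → E, AnalyticAt ℝ Ψ 0 ∧
      ∀ᶠ z in 𝓝 (0 : ℝ × E), z.2 = z.1 • H z.2 → z.2 = Ψ z.1 := by
  -- Solutions are exactly the points that `G` sends to (ε, 0). The derivative of `G` at 0 is
  -- triangular, hence invertible whatever `H 0` is, so the analytic inverse function theorem
  -- applies.
  let G : ℝ × E → ℝ × E := fun z => (z.1, z.2 - z.1 • H z.2)
  have hH2 : AnalyticAt ℝ (fun z : ℝ × E => H z.2) 0 :=
    AnalyticAt.comp (g := H) (f := Prod.snd) hH analyticAt_snd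
  have hG : AnalyticAt ℝ G 0 :=
    analyticAt_fst.prod (analyticAt_snd.sub (analyticAt_fst.smul hH2))
  let G' : (ℝ × E) ≃L[ℝ] (ℝ × E) :=
    (ContinuousLinearEquiv.refl ℝ ℝ).skewProd (ContinuousLinearEquiv.refl ℝ _)
      (-(ContinuousLinearMap.id ℝ ℝ).smulRight (H 0))
  have hG' : HasFDerivAt G (G' : _ →L[ℝ] _) 0 := by
    have h2 := (hasFDerivAt_fst (𝕜 := ℝ) (p := (0 : ℝ × E))).prodMk (hasFDerivAt_snd.sub
      ((hasFDerivAt_fst (𝕜 := ℝ) (p := (0 : ℝ × E))).smul hH2.differentiableAt.hasFDerivAt))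
    refine h2.congr_fderiv ?_
    ext z <;> simp [G', sub_eq_add_neg]
  let L := hG.contDiffAt.localInverse (n := ω) hG' (by simp)
  have hG0 : G 0 = 0 := by simp [G]
  have hL : AnalyticAt ℝ L 0 := by
    have := hG.contDiffAt.to_localInverse (n := ω) hG' (by simp)
    rw [hG0] at this
    exact this.analyticAt
  have hinv : ∀ᶠ z in 𝓝 (0 : ℝ × E), L (G z) = z :=
    (hG.contDiffAt.hasStrictFDerivAt' hG' (by simp : (ω : WithTop ℕ∞) ≠ 0)).eventually_left_inverse
  refine ⟨fun ε => (L (ε, 0)).2, ?_, ?_⟩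
  · have h1 : AnalyticAt ℝ (fun ε : ℝ => L (ε, 0)) 0 :=
      AnalyticAt.comp (g := L) (f := fun ε : ℝ => (ε, (0 : E))) hL
        (analyticAt_id.prod analyticAt_const)
    exact AnalyticAt.comp (g := Prod.snd) analyticAt_snd h1
  · filter_upwards [hinv] with z hz h
    have : G z = (z.1, 0) := by simp only [G, ← h, sub_self]
    rw [← this, hz]

/-- An integral curve of an analytic vector field is analytic. -/
theorem AnalyticAt.analyticAt_integralCurve [CompleteSpace E] {f : E → E} {γ : ℝ → E}
    (hf : AnalyticAt ℝ f (γ 0)) (hγ : ∀ᶠ t in 𝓝 0, HasDerivAt γ (f (γ t)) t) :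
    AnalyticAt ℝ γ 0 := by
  obtain ⟨p, R, hp⟩ := hf
  -- For small ψ, `q.sum ψ` is s ↦ f(γ 0 + ψ s). The rescaled curve ψ(s) = γ(εs) - γ 0 solves ψ = ε
  -- • `unitPrimitive` (`q.sum ψ`), so it depends analytically on ε; evaluation at s = 1 recovers
  -- γ(ε).
  let q := p.pointwise (Icc (0 : ℝ) 1)
  have hqr : 0 < q.radius :=
    (hp.r_pos.trans_le hp.r_le).trans_le p.radius_le_radius_pointwise
  have hq : AnalyticAt ℝ q.sum 0 := (q.hasFPowerSeriesOnBall hqr).analyticAt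
  have hJ : AnalyticAt ℝ (fun ψ => unitPrimitive (q.sum ψ)) 0 :=
    (ContinuousLinearMap.analyticAt (𝕜 := ℝ) (E := C(Icc (0 : ℝ) 1, E))
      (F := C(Icc (0 : ℝ) 1, E)) unitPrimitive _).comp hq
  obtain ⟨Ψ, hΨ, hΨe⟩ := hJ.exists_analyticAt_eq_smul
  have hA : AnalyticAt ℝ (fun ε : ℝ => γ 0 + Ψ ε 1) 0 :=
    analyticAt_const.add ((ContinuousLinearMap.analyticAt (𝕜 := ℝ) (E := C(Icc (0 : ℝ) 1, E))
      (F := E) (ContinuousMap.evalCLM ℝ (1 : Icc (0 : ℝ) 1)) _).comp hΨ)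
  refine hA.congr ?_
  obtain ⟨R', hR', hRR⟩ := ENNReal.lt_iff_exists_nnreal_btwn.1 hp.r_pos
  replace hR' : (0 : ℝ) < R' := by exact_mod_cast hR'
  obtain ⟨ρ, hρ, hball⟩ := Metric.eventually_nhds_iff_ball.1 hΨe
  have hcont : ContinuousAt γ 0 := hγ.self_of_nhds.continuousAt
  obtain ⟨δ, hδ, hδt⟩ := Metric.eventually_nhds_iff_ball.1
    -- `R'` keeps ψ where the power series converges; `ρ / 2` keeps its sup norm strictly below the
    -- radius `ρ` on which small solutions are unique.
    (hγ.and (hcont.eventually (Metric.ball_mem_nhds (γ 0) (lt_min hR' (half_pos hρ)))))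
  filter_upwards [Metric.ball_mem_nhds (0 : ℝ) (lt_min hδ hρ)] with ε hε
  simp only [Metric.mem_ball, dist_zero_right, Real.norm_eq_abs, lt_min_iff] at hε hδt
  have hmem (u : Icc (0 : ℝ) 1) : |ε * u| < δ := by
    rw [abs_mul, abs_of_nonneg u.2.1]
    exact (mul_le_of_le_one_right (abs_nonneg _) u.2.2).trans_lt hε.1
  let ψ : C(Icc (0 : ℝ) 1, E) := ⟨fun s => γ (ε * s) - γ 0, by
    refine Continuous.sub ?_ continuous_const
    refine continuous_iff_continuousAt.2 fun s => ?_
    exact ContinuousAt.comp (g := γ) (f := fun s : Icc (0 : ℝ) 1 => ε * s)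
      (hδt _ (hmem s)).1.continuousAt (by fun_prop)⟩
  have hψs (s : Icc (0 : ℝ) 1) : ψ s = γ (ε * s) - γ 0 := rfl
  have hψR (s : Icc (0 : ℝ) 1) : ‖ψ s‖ < R' ∧ ‖ψ s‖ < ρ / 2 := by
    have := (hδt _ (hmem s)).2
    rwa [dist_eq_norm] at this
  have hψn : ‖ψ‖ < ρ :=
    ((ContinuousMap.norm_le _ (half_pos hρ).le).2 fun s => (hψR s).2.le).trans_lt (half_lt_self hρ)
  have hψR' : ψ ∈ Metric.eball (0 : C(Icc (0 : ℝ) 1, E)) R := by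
    have h1 : ‖ψ‖ < R' := (ContinuousMap.norm_lt_iff _ hR').2 fun s => (hψR s).1
    rw [mem_eball_zero_iff]
    exact lt_trans (by rw [enorm_eq_nnnorm]; exact_mod_cast h1) hRR
  have hsum (s : Icc (0 : ℝ) 1) : q.sum ψ s = f (γ (ε * s)) := by
    rw [p.sum_pointwise_apply (Metric.eball_subset_eball hp.r_le hψR'),
      ← hp.sum (by
      rw [mem_eball_zero_iff]
      exact lt_trans (by rw [enorm_eq_nnnorm]; exact_mod_cast (hψR s).1) hRR), hψs, add_sub_cancel]
  have hfix : ψ = ε • unitPrimitive (q.sum ψ) := by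
    ext s
    have hd : ∀ u ∈ uIcc (0 : ℝ) s, HasDerivAt (fun u => γ (ε * u))
        (ε • q.sum ψ (projIcc 0 1 zero_le_one u)) u := by
      intro u hu
      rw [uIcc_of_le s.2.1] at hu
      have hu' : u ∈ Icc (0 : ℝ) 1 := ⟨hu.1, hu.2.trans s.2.2⟩
      rw [projIcc_of_mem _ hu', hsum]
      exact (hδt _ (hmem ⟨u, hu'⟩)).1.scomp u (by simpa using (hasDerivAt_id u).const_mul ε)
    have hi := intervalIntegral.integral_eq_sub_of_hasDerivAt hd
      ((((q.sum ψ).continuous.comp continuous_projIcc).const_smul ε).intervalIntegrable _ _)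
    rw [intervalIntegral.integral_smul] at hi
    rw [ContinuousMap.smul_apply, unitPrimitive_apply, hi, hψs, mul_zero]
  have key := hball (ε, ψ) (by
    rw [mem_ball_zero_iff, Prod.norm_def]; exact max_lt hε.2 hψn) hfix
  simp only at key
  rw [← key, hψs]
  simp

end ODE

/-! ### Transport of annihilating covectors -/

section LieTransport

variable {E : Type*} [NormedAddCommGroup E] [NormedSpace ℝ E]

/-- An analytic function on a preconnected open set of reals, belonging to a family of analytic
functions that is stable under differentiation and vanishes at a point, is zero. -/
theorem AnalyticOnNhd.eqOn_zero_of_family_deriv {ι : Type*} {T : Set ℝ} (hT : IsOpen T)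
    (hTc : IsPreconnected T) {t₀ : ℝ} (ht₀ : t₀ ∈ T) {g : ι → ℝ → ℝ} {D : ι → ι}
    (hg : ∀ i, AnalyticOnNhd ℝ (g i) T) (hD : ∀ i, ∀ t ∈ T, HasDerivAt (g i) (g (D i) t) t)
    (h0 : ∀ i, g i t₀ = 0) (i : ι) : EqOn (g i) 0 T := by
  -- The induction must run over all `i` at once, since differentiating replaces `i` by `D i`.
  have hit (n : ℕ) : ∀ i, iteratedDeriv n (g i) t₀ = 0 := by
    induction n with
    | zero => simpa using h0
    | succ n ih =>
      intro i
      rw [iteratedDeriv_succ', ← ih (D i)]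
      refine Filter.EventuallyEq.iteratedDeriv_eq n ?_
      filter_upwards [hT.mem_nhds ht₀] with t ht using (hD i t ht).deriv
  refine (hg i).eqOn_zero_of_preconnected_of_eventuallyEq_zero hTc ht₀ ?_
  refine analyticOrderAt_eq_top.1 (ENat.eq_top_iff_forall_ge.2 fun n => ?_)
  exact (natCast_le_analyticOrderAt_iff_iteratedDeriv_eq_zero (hg i t₀ ht₀)).2 fun k _ => hit k i

/-- Infinitesimal invariance implies invariance along integral curves: if a covector `l` at `x₀`
annihilates a family of analytic vector fields stable under bracket with `f`, then there is an
integral curve `γ` of `f` from `x₀` and a curve of nonzero covectors annihilating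
the family along `γ`. -/
theorem exists_integralCurve_annihilator [CompleteSpace E] {U : Set E} (hU : IsOpen U)
    {f : E → E} (hf : AnalyticOnNhd ℝ f U) {𝒱 : Set (E → E)}
    (h𝒱 : ∀ V ∈ 𝒱, AnalyticOnNhd ℝ V U)
    (hbr : ∀ V ∈ 𝒱, ∃ W ∈ 𝒱, EqOn (VectorField.lieBracket ℝ f V) W U)
    {x₀ : E} (hx₀ : x₀ ∈ U) {l : E →L[ℝ] ℝ} (hl : l ≠ 0) (hl𝒱 : ∀ V ∈ 𝒱, l (V x₀) = 0) :
    ∃ γ : ℝ → E, γ 0 = x₀ ∧ HasDerivAt γ (f x₀) 0 ∧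
      ∀ᶠ t in 𝓝 0, γ t ∈ U ∧ ∃ p : E →L[ℝ] ℝ, p ≠ 0 ∧ ∀ V ∈ 𝒱, p (V (γ t)) = 0 := by
  -- Curve and covector form one autonomous analytic system, so both components of its solution are
  -- analytic.
  let F : E × (E →L[ℝ] ℝ) → E × (E →L[ℝ] ℝ) := fun z => (f z.1, -(z.2.comp (fderiv ℝ f z.1)))
  have hF : AnalyticAt ℝ F (x₀, l) := by
    have h1 : AnalyticAt ℝ (fun z : E × (E →L[ℝ] ℝ) => f z.1) (x₀, l) :=
      AnalyticAt.comp (g := f) (f := Prod.fst) (hf _ hx₀) analyticAt_fst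
    have h2 : AnalyticAt ℝ (fun z : E × (E →L[ℝ] ℝ) => fderiv ℝ f z.1) (x₀, l) :=
      AnalyticAt.comp (g := fderiv ℝ f) (f := Prod.fst) (hf _ hx₀).fderiv analyticAt_fst
    have h3 : AnalyticAt ℝ (fun z : E × (E →L[ℝ] ℝ) => z.2.comp (fderiv ℝ f z.1)) (x₀, l) := by
      exact ((ContinuousLinearMap.compL ℝ E E ℝ).analyticAt_bilinear _).comp₂ analyticAt_snd h2
    exact h1.prod h3.neg
  obtain ⟨α, hα0, ε, hε, hα⟩ :=
    ContDiffAt.exists_forall_mem_closedBall_exists_eq_forall_mem_Ioo_hasDerivAt₀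
      (hF.contDiffAt (n := 1)) 0
  have hαd : ∀ᶠ t in 𝓝 (0 : ℝ), HasDerivAt α (F (α t)) t := by
    filter_upwards [Ioo_mem_nhds (a := 0 - ε) (b := 0 + ε) (x := 0) (by linarith) (by linarith)]
      with t ht using hα t ht
  have hαa : AnalyticAt ℝ α 0 :=
    AnalyticAt.analyticAt_integralCurve (by rwa [hα0]) hαd
  have hαU : ∀ᶠ t in 𝓝 (0 : ℝ), (α t).1 ∈ U :=
    hαa.continuousAt.fst.eventually (hU.mem_nhds (by simpa [hα0]))
  have hαl : ∀ᶠ t in 𝓝 (0 : ℝ), (α t).2 ≠ 0 :=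
    hαa.continuousAt.snd.eventually (isOpen_ne.mem_nhds (by simpa [hα0]))
  obtain ⟨δ, hδ, hball⟩ := Metric.eventually_nhds_iff_ball.1
    (hαd.and (hαa.eventually_analyticAt.and (hαU.and hαl)))
  have h0 : (0 : ℝ) ∈ Metric.ball (0 : ℝ) δ := Metric.mem_ball_self hδ
  choose! D hD𝒱 hD using hbr
  have hg := AnalyticOnNhd.eqOn_zero_of_family_deriv (ι := 𝒱) Metric.isOpen_ball
    (convex_ball (0 : ℝ) δ).isPreconnected h0 (g := fun V t => (α t).2 (V.1 (α t).1))
    (D := fun V => ⟨D V, hD𝒱 V V.2⟩) ?_ ?_ ?_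
  · refine ⟨fun t => (α t).1, by simp [hα0], ?_, ?_⟩
    · have := hasFDerivAt_fst.comp_hasDerivAt 0 (hball 0 h0).1
      rwa [hα0] at this
    · filter_upwards [Metric.ball_mem_nhds (0 : ℝ) hδ] with t ht
      exact ⟨(hball t ht).2.2.1, (α t).2, (hball t ht).2.2.2, fun V hV => hg ⟨V, hV⟩ ht⟩
  · intro V t ht
    obtain ⟨-, h1, h2, -⟩ := hball t ht
    have h3 : AnalyticAt ℝ (fun t => (α t).1) t := analyticAt_fst.comp h1
    have h4 : AnalyticAt ℝ (fun t => (α t).2) t := analyticAt_snd.comp h1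
    exact ((ContinuousLinearMap.id ℝ (E →L[ℝ] ℝ)).analyticAt_bilinear _).comp₂ h4
      (AnalyticAt.comp (g := V.1) (h𝒱 V V.2 _ h2) h3)
  · intro V t ht
    obtain ⟨h1, -, h2, -⟩ := hball t ht
    have h5 : HasDerivAt (fun t => (α t).1) (f (α t).1) t :=
      (hasFDerivAt_fst (p := α t)).comp_hasDerivAt t h1
    have h6 : HasDerivAt (fun t => (α t).2) (-((α t).2.comp (fderiv ℝ f (α t).1))) t :=
      (hasFDerivAt_snd (p := α t)).comp_hasDerivAt t h1
    have h3 : HasDerivAt (fun t => V.1 (α t).1) (fderiv ℝ V.1 (α t).1 (f (α t).1)) t :=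
      ((h𝒱 V V.2 _ h2).differentiableAt.hasFDerivAt.comp_hasDerivAt t h5)
    -- The product rule gives -p(Df V) + p(DV f), which is p([f, V]).
    have h4 := h6.clm_apply h3
    refine h4.congr_deriv ?_
    simp only [← hD V V.2 h2, VectorField.lieBracket]
    simp
    ring
  · intro V
    simpa [hα0] using hl𝒱 V V.2

end LieTransport

/-! ### Vector fields in charts -/

section Chart

variable {d r : ℕ} {N : Type*} [TopologicalSpace N]
  [ChartedSpace (EuclideanSpace ℝ (Fin d)) N]

variable {φ : OpenPartialHomeomorph N (EuclideanSpace ℝ (Fin d))}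

theorem mdifferentiable_of_mem_maximalAtlas (hφ : φ ∈ IsManifold.maximalAtlas (𝓡 d) ω N) :
    φ.MDifferentiable (𝓡 d) (𝓡 d) :=
  ⟨(contMDiffOn_of_mem_maximalAtlas hφ).mdifferentiableOn (by simp),
    (contMDiffOn_symm_of_mem_maximalAtlas hφ).mdifferentiableOn (by simp)⟩

theorem isInvertible_mfderiv_chart_symm (hφ : φ ∈ IsManifold.maximalAtlas (𝓡 d) ω N)
    {x : EuclideanSpace ℝ (Fin d)} (hx : x ∈ φ.target) :
    (mfderiv (𝓡 d) (𝓡 d) φ.symm x).IsInvertible :=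
  ⟨(mdifferentiable_of_mem_maximalAtlas hφ).symm.mfderiv hx, rfl⟩

/-- The expression of a vector field in a chart. -/
noncomputable def chartField (φ : OpenPartialHomeomorph N (EuclideanSpace ℝ (Fin d)))
    (V : (x : N) → TangentSpace (𝓡 d) x) : EuclideanSpace ℝ (Fin d) → EuclideanSpace ℝ (Fin d) :=
  VectorField.mpullback (𝓡 d) (𝓡 d) φ.symm V

theorem mfderiv_chart_symm_chartField (hφ : φ ∈ IsManifold.maximalAtlas (𝓡 d) ω N)
    (V : (x : N) → TangentSpace (𝓡 d) x) {x : EuclideanSpace ℝ (Fin d)} (hx : x ∈ φ.target) :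
    mfderiv (𝓡 d) (𝓡 d) φ.symm x (chartField φ V x) = V (φ.symm x) :=
  ((isInvertible_mfderiv_chart_symm hφ hx).inverse_apply_eq.1 rfl).symm

/-- The derivative of `Φ ∘ φ` along a vector field is computed in the chart `φ`. -/
theorem mfderiv_comp_chart_apply (hφ : φ ∈ IsManifold.maximalAtlas (𝓡 d) ω N)
    (V : (x : N) → TangentSpace (𝓡 d) x) {Φ : EuclideanSpace ℝ (Fin d) → ℝ}
    {x : EuclideanSpace ℝ (Fin d)} (hx : x ∈ φ.target) (hΦ : DifferentiableAt ℝ Φ x) :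
    mfderiv (𝓡 d) 𝓘(ℝ, ℝ) (Φ ∘ φ) (φ.symm x) (V (φ.symm x)) =
      fderiv ℝ Φ x (chartField φ V x) := by
  have hxs := φ.map_target hx
  have hφd := mdifferentiable_of_mem_maximalAtlas hφ
  have hΦφ : MDifferentiableAt (𝓡 d) 𝓘(ℝ, ℝ) (Φ ∘ φ) (φ.symm x) := by
    refine MDifferentiableAt.comp (I' := 𝓡 d) _ ?_ (hφd.mdifferentiableAt hxs)
    rw [φ.right_inv hx]
    exact hΦ.mdifferentiableAt
  have hev : Φ =ᶠ[𝓝 x] (Φ ∘ φ) ∘ φ.symm := by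
    filter_upwards [φ.open_target.mem_nhds hx] with z hz
    simp [φ.right_inv hz]
  have hc := mfderiv_comp_apply x hΦφ (hφd.mdifferentiableAt_symm hx) (chartField φ V x)
  rw [mfderiv_chart_symm_chartField hφ V hx] at hc
  rw [← hc, ← mfderiv_eq_fderiv, hev.mfderiv_eq]
  rfl

/-- The parabolic Hörmander condition at a point means that no nonzero covector annihilates the
expressions of the Lie algebra in a chart. -/
theorem parabolicHormanderAt_iff_chartField (hφ : φ ∈ IsManifold.maximalAtlas (𝓡 d) ω N)
    (Y : Fin (r + 1) → (x : N) → TangentSpace (𝓡 d) x)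
    {x : EuclideanSpace ℝ (Fin d)} (hx : x ∈ φ.target) :
    ParabolicHormanderAt Y (φ.symm x) ↔ ∀ p : EuclideanSpace ℝ (Fin d) →L[ℝ] ℝ,
      (∀ V, ParabolicLieAlgebra Y V → p (chartField φ V x) = 0) → p = 0 := by
  -- `A` is the differential of `φ.symm` at `x`; composing with `A` or its inverse exchanges
  -- covectors on the tangent space and on the coordinate space.
  obtain ⟨A, hA⟩ : ∃ A : EuclideanSpace ℝ (Fin d) ≃L[ℝ] EuclideanSpace ℝ (Fin d),
      ∀ V : (x : N) → TangentSpace (𝓡 d) x, A (chartField φ V x) = V (φ.symm x) := by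
    obtain ⟨A, hA⟩ := isInvertible_mfderiv_chart_symm hφ hx
    refine ⟨A, fun V => ?_⟩
    rw [← mfderiv_chart_symm_chartField hφ V hx, ← hA]
    rfl
  let S : Set (EuclideanSpace ℝ (Fin d)) :=
    {v | ∃ V, ParabolicLieAlgebra Y V ∧ V (φ.symm x) = v}
  change Submodule.span ℝ S = ⊤ ↔ _
  constructor
  · intro h p hp
    have hle : Submodule.span ℝ S ≤
        ((p.comp (A.symm : _ →L[ℝ] EuclideanSpace ℝ (Fin d))).toLinearMap).ker := by
      refine Submodule.span_le.2 ?_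
      rintro _ ⟨V, hV, rfl⟩
      rw [← hA V]
      simpa using hp V hV
    rw [h] at hle
    ext v
    simpa using hle (Submodule.mem_top (x := A v))
  · intro h
    by_contra hne
    obtain ⟨l, hl0, hl⟩ := Submodule.exists_le_ker_of_lt_top _ (lt_top_iff_ne_top.2 hne)
    have hp := h (l.toContinuousLinearMap.comp (A : _ →L[ℝ] EuclideanSpace ℝ (Fin d)))
      fun V hV => by
        have : l (A (chartField φ V x)) = 0 := by
          rw [hA]
          exact hl (Submodule.subset_span ⟨V, hV, rfl⟩)
        exact this
    refine hl0 (LinearMap.ext fun v => ?_)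
    have := DFunLike.congr_fun hp (A.symm v)
    simpa using this

variable [IsManifold (𝓡 d) ω N]

theorem ParabolicLieAlgebra.contMDiff {Y : Fin (r + 1) → (x : N) → TangentSpace (𝓡 d) x}
    (hY : AnalyticVectorFields Y) {V : (x : N) → TangentSpace (𝓡 d) x}
    (hV : ParabolicLieAlgebra Y V) :
    ContMDiff (𝓡 d) (𝓡 d).tangent ω (fun x => (⟨x, V x⟩ : TangentBundle (𝓡 d) N)) := by
  -- `ω + 1` is `ω`: a bracket costs no regularity in the analytic class.
  have : IsManifold (𝓡 d) (ω + 1) N := ‹IsManifold (𝓡 d) ω N›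
  have hbr {V W : (x : N) → TangentSpace (𝓡 d) x}
      (hV : ContMDiff (𝓡 d) (𝓡 d).tangent ω (fun x => (⟨x, V x⟩ : TangentBundle (𝓡 d) N)))
      (hW : ContMDiff (𝓡 d) (𝓡 d).tangent ω (fun x => (⟨x, W x⟩ : TangentBundle (𝓡 d) N))) :
      ContMDiff (𝓡 d) (𝓡 d).tangent ω
        (fun x => (⟨x, VectorField.mlieBracket (𝓡 d) V W x⟩ : TangentBundle (𝓡 d) N)) := by
    intro x
    have := (hV x).contMDiffWithinAt.mlieBracketWithin_vectorField (m := ω) (s := univ)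
      (hW x).contMDiffWithinAt uniqueMDiffOn_univ (mem_univ x) (by simp)
    simpa [VectorField.mlieBracketWithin_univ, contMDiffWithinAt_univ] using this
  induction hV with
  | generator k => exact hY _
  | zero => exact Bundle.contMDiff_zeroSection ℝ _
  | add _ _ h1 h2 => exact h1.add_section h2
  | smul c _ h => exact h.const_smul_section
  | bracket _ _ h1 h2 => exact hbr h1 h2
  | drift _ h => exact hbr (hY 0) h

theorem analyticOnNhd_chartField (hφ : φ ∈ IsManifold.maximalAtlas (𝓡 d) ω N)
    {V : (x : N) → TangentSpace (𝓡 d) x}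
    (hV : ContMDiff (𝓡 d) (𝓡 d).tangent ω (fun x => (⟨x, V x⟩ : TangentBundle (𝓡 d) N))) :
    AnalyticOnNhd ℝ (chartField φ V) φ.target := by
  have : IsManifold (𝓡 d) (ω + 1) N := ‹IsManifold (𝓡 d) ω N›
  intro x hx
  have h := ContMDiffAt.mpullback_vectorField_preimage (m := ω) (hV (φ.symm x))
    (contMDiffAt_symm_of_mem_maximalAtlas hφ hx) (isInvertible_mfderiv_chart_symm hφ hx) (by simp)
  have h2 := contMDiffAt_vectorSpace_iff_contDiffAt.1 h
  exact h2.analyticAt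

/-- Naturality of the bracket under pullback; it carries the stability of the ideal over to
coordinates. -/
theorem chartField_mlieBracket (hφ : φ ∈ IsManifold.maximalAtlas (𝓡 d) ω N)
    {V W : (x : N) → TangentSpace (𝓡 d) x}
    (hV : ContMDiff (𝓡 d) (𝓡 d).tangent ω (fun x => (⟨x, V x⟩ : TangentBundle (𝓡 d) N)))
    (hW : ContMDiff (𝓡 d) (𝓡 d).tangent ω (fun x => (⟨x, W x⟩ : TangentBundle (𝓡 d) N))) :
    EqOn (VectorField.lieBracket ℝ (chartField φ V) (chartField φ W))
      (chartField φ (VectorField.mlieBracket (𝓡 d) V W)) φ.target := by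
  have : IsManifold (𝓡 d) (minSmoothness ℝ 2) N := IsManifold.of_le (n := ω) le_top
  intro x hx
  have h := VectorField.mpullback_mlieBracket (n := ω) (x₀ := x) (f := φ.symm)
    ((hV (φ.symm x)).mdifferentiableAt (by simp)) ((hW (φ.symm x)).mdifferentiableAt (by simp))
    (contMDiffAt_symm_of_mem_maximalAtlas hφ hx) le_top
  rw [← VectorField.mlieBracketWithin_univ (I := 𝓡 d) (M := EuclideanSpace ℝ (Fin d)),
    VectorField.mlieBracketWithin_eq_lieBracketWithin] at h
  rw [← VectorField.lieBracketWithin_univ]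
  exact h.symm

end Chart

/-! ### The equivalence -/

theorem corollary2p5 {d r : ℕ} {N : Type*} [TopologicalSpace N]
    [ChartedSpace (EuclideanSpace ℝ (Fin d)) N] [IsManifold (𝓡 d) ω N]
    (Y : Fin (r + 1) → (x : N) → TangentSpace (𝓡 d) x) (hY : AnalyticVectorFields Y) :
    (∃ B : Set N, ConditionH1 Y B ∧ ConditionH2 Y B) ↔ ∀ y : N, ParabolicHormanderAt Y y := by
  refine ⟨?_, fun h => ⟨∅, ⟨fun y _ => h y, by simp⟩, by simp [ConditionH2]⟩⟩
  rintro ⟨B, ⟨hB, -⟩, hB2⟩ y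
  by_cases hy : y ∈ B
  swap
  · exact hB y hy
  obtain ⟨φ, hφ, hyφ, Φ, hΦ, -, hBΦ, k, hk⟩ := hB2 y hy
  obtain ⟨x, hxt, rfl⟩ : ∃ x ∈ φ.target, φ.symm x = y :=
    ⟨φ y, φ.map_source hyφ, φ.left_inv hyφ⟩
  have hΦd : DifferentiableAt ℝ Φ x :=
    (hΦ.contDiffAt (φ.open_target.mem_nhds hxt)).differentiableAt (by simp)
  rw [mfderiv_comp_chart_apply hφ (Y k) hxt hΦd] at hk
  rw [parabolicHormanderAt_iff_chartField hφ Y hxt]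
  intro l hl
  by_contra hl0
  -- The ideal is stable under every `Y k`: under the drift by definition, under the others because
  -- they lie in it.
  have hbr (V : (x : N) → TangentSpace (𝓡 d) x) (hV : ParabolicLieAlgebra Y V) :
      ParabolicLieAlgebra Y (VectorField.mlieBracket (𝓡 d) (Y k) V) := by
    rcases Fin.eq_zero_or_eq_succ k with rfl | ⟨j, rfl⟩
    · exact hV.drift
    · exact (ParabolicLieAlgebra.generator j).bracket hV
  obtain ⟨γ, hγ0, hγd, hγ⟩ := exists_integralCurve_annihilator φ.open_target
    (analyticOnNhd_chartField hφ (hY k)) (𝒱 := chartField φ '' {V | ParabolicLieAlgebra Y V})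
    (by rintro _ ⟨V, hV, rfl⟩; exact analyticOnNhd_chartField hφ (hV.contMDiff hY))
    (by
      rintro _ ⟨V, hV, rfl⟩
      exact ⟨_, ⟨_, hbr V hV, rfl⟩, chartField_mlieBracket hφ (hY k) (hV.contMDiff hY)⟩)
    hxt hl0 (by rintro _ ⟨V, hV, rfl⟩; exact hl V hV)
  -- By `hk`, Φ ∘ γ has nonzero derivative at 0, so any value, in particular 0, is avoided at small
  -- nonzero times.
  have hne : ∀ᶠ t in 𝓝[≠] 0, Φ (γ t) ≠ 0 := by
    rw [← hγ0] at hΦd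
    have h := hΦd.hasFDerivAt.comp_hasDerivAt 0 hγd
    rw [hγ0] at h
    exact h.eventually_ne hk
  obtain ⟨t, ht, hγt, p, hp, hpV⟩ := (hne.and (hγ.filter_mono nhdsWithin_le_nhds)).exists
  have hH := hB (φ.symm (γ t)) fun hmem => ht (by
    have := (hBΦ ⟨_, ⟨hmem, φ.map_target hγt⟩, rfl⟩).2
    rwa [φ.right_inv hγt] at this)
  rw [parabolicHormanderAt_iff_chartField hφ Y hγt] at hH
  exact hp (hH p fun V hV => hpV _ ⟨V, hV, rfl⟩)
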